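/- **Setting.** Consider an unknown single-input system $\dot x = f(x) + g(x)u$ on $\mathbb R^n$ with $f(0)=0$, a compact convex set $\mathbb X\subset\mathbb R^n$, and a compact set $\mathbb U\subset\mathbb R$ with $0\in\operatorname{int}\mathbb U$. For every constant input $u\in\mathbb U$ and every $\hat x\in\mathbb X$ the solution $x(t;\hat x,u)$, $t\ge 0$, exists and is unique. Let $\phi_0\equiv 1$, $\phi_k(x)=x_k$ for $1\le k\le n$, and $\phi_k\in C^2(\mathbb R^n,\mathbb R)$ with $\phi_k(0)=0$ for $n<k\le N$. Put $\hat\Phi=(\phi_1,\dots,\phi_N)^\top$, $\Phi=(1,\hat\Phi^\top)^\top$ and $\mathbb V=\operatorname{span}\{\phi_0,\dots,\phi_N\}$. Assume that $\mathbb V$ is invariant: for all $\phi\in\mathbb V$, $u\in\mathbb U$ and $t\ge0$, the function $\hat x\mapsto\phi(x(t;\hat x,u))$ on $\mathbb X$ belongs to $\mathbb V$. **Data.** Let $\rho$ be a probability measure on $\mathbb X$ (for instance the uniform one) for which $\phi_0,\dots,\phi_N$ are linearly independent in $L^2(\rho)$. Draw independent samples $x^0_1,\dots,x^0_{d^0},x^1_1,\dots,x^1_{d^1}$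 with law $\rho$, with derivatives $\dot x^0_j=f(x^0_j)$ and $\dot x^1_j=f(x^1_j)+g(x^1_j)$. Let $X^0$ and $X^1$ have the columns $\hat\Phi(x^0_j)$ and $\Phi(x^1_j)$, respectively, and for $u\in\{0,1\}$ let $Y^u$ have the columns $\big(\langle\nabla\phi_k(x^u_j),\dot x^u_j\rangle\big)_{k=1}^N$. Let $A\in\mathbb R^{N\times N}$ minimize $\|Y^0-AX^0\|_{\mathrm F}$, let $[B_0\ \hat B]\in\mathbb R^{N\times(1+N)}$ minimize $\|Y^1-[B_0\ \hat B]X^1\|_{\mathrm F}$, and set $B_1=\hat B-A$. **Theorem 1.** Let $c_r>0$ and $\delta\in(0,1)$. There is $d_0\in\mathbb N$ such that for all $d^0,d^1\ge d_0$, with probability at least $1-\delta$ over the data, the following holds for any such $A,B_0,B_1$. Let $Q_z\in\mathbb R^{N\times N}$ be symmetric with $Q_z\prec0$, let $S_z\in\mathbb R^N$ and $R_z>0$, and set $\begin{bmatrix}\tilde Q_z&\tilde S_z\\ \tilde S_z^\top&\tilde R_z\end{bmatrix}=\begin{bmatrix}Q_z&S_z\\ S_z^\top&R_z\end{bmatrix}^{-1}$.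 Suppose that $P=P^\top\succ0$ in $\mathbb R^{N\times N}$, $L\in\mathbb R^{1\times N}$ and $\lambda,\nu,\tau>0$ satisfy $$\begin{bmatrix}-AP-B_0L-PA^\top-L^\top B_0^\top-\tau I_N & -L^\top-\lambda B_1\tilde S_z & -[P\ \ L^\top] & \lambda B_1\\ -L-\lambda\tilde S_z^\top B_1^\top & \lambda\tilde R_z & 0&0\\ -[P\ \ L^\top]^\top&0&\tfrac12\tau c_r^{-2}I_{N+1}&0\\ \lambda B_1^\top&0&0&-\lambda\tilde Q_z^{-1}\end{bmatrix}\succ0$$ and $$\begin{bmatrix}P&PS_z&P&0\\ S_z^\top P&\nu R_z&0&\nu\\ P&0&-\nu Q_z^{-1}&0\\ 0&\nu&0&1\end{bmatrix}\succeq0,$$ and that $\mathcal X_{\mathrm{RoA}}=\{x\in\mathbb R^n:\hat\Phi(x)^\top P^{-1}\hat\Phi(x)\le1\}$ is contained in $\mathbb X$. Then the feedback $\mu(x)=LP^{-1}\hat\Phi(x)$ exponentially stabilizes the system on $\mathcal X_{\mathrm{RoA}}$: for every $\hat x\in\mathcal X_{\mathrm{RoA}}$ the closed loop $\dot x=f(x)+g(x)\mu(x)$,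 $x(0)=\hat x$, has a unique solution on $[0,\infty)$, and $\|x(t)\|\le Me^{-\alpha t}\|\hat x\|$ for all $t\ge0$, with constants $M,\alpha>0$ independent of $\hat x$. Moreover, $\mathcal X_{\mathrm{RoA}}$ is positively invariant for the closed loop. -/

import Mathlib

open MeasureTheory Set
open scoped Matrix

namespace KoopmanFeedback

/-! ### Ordinary differential equations -/

/-- `x : [0,∞) → E` is a (classical) solution of `ẋ = F(x)`, `x(0) = x₀`. -/
def IsSolution {E : Type*} [NormedAddCommGroup E] [NormedSpace ℝ E]
    (F : E → E) (x₀ : E) (x : ℝ → E) : Prop :=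
  x 0 = x₀ ∧ ∀ t ∈ Ici (0 : ℝ), HasDerivWithinAt x (F (x t)) (Ici 0) t

/-- Existence and uniqueness of the solution of `ẋ = F(x)` on `[0,∞)` for every initial
condition in `S`. -/
def WellPosedOn {E : Type*} [NormedAddCommGroup E] [NormedSpace ℝ E]
    (F : E → E) (S : Set E) : Prop :=
  ∀ x₀ ∈ S, ∃ x : ℝ → E, IsSolution F x₀ x ∧
    ∀ y : ℝ → E, IsSolution F x₀ y → EqOn y x (Ici 0)

/-- Positive invariance of `S` for `ẋ = F(x)`. -/
def PositivelyInvariant {E : Type*} [NormedAddCommGroup E] [NormedSpace ℝ E]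
    (F : E → E) (S : Set E) : Prop :=
  ∀ x₀ ∈ S, ∀ x : ℝ → E, IsSolution F x₀ x → ∀ t ∈ Ici (0 : ℝ), x t ∈ S

/-- Exponential stability of the origin of `ẋ = F(x)` for all initial conditions in `S`: the
solutions exist on `[0,∞)`, are unique, and decay exponentially, with uniform constants. -/
def ExponentiallyStableOn {E : Type*} [NormedAddCommGroup E] [NormedSpace ℝ E]
    (F : E → E) (S : Set E) : Prop :=
  WellPosedOn F S ∧
  ∃ M > (0 : ℝ), ∃ α > (0 : ℝ), ∀ x₀ ∈ S, ∀ x : ℝ → E, IsSolution F x₀ x →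
    ∀ t ∈ Ici (0 : ℝ), ‖x t‖ ≤ M * Real.exp (-α * t) * ‖x₀‖

/-! ### The dictionary

The observables are the constant `1`, the `n` coordinates, and `q` further functions `ψ`, so that
`N = n + q`. Coordinates of the reduced lifted state are indexed by `Fin n ⊕ Fin q`, those of the
lifted state by `Fin 1 ⊕ (Fin n ⊕ Fin q)`. -/

/-- The reduced lifted state `Φ̂(x) = (x, ψ(x)) ∈ ℝᴺ`. -/
def liftHat {n q : ℕ} (ψ : Fin q → EuclideanSpace ℝ (Fin n) → ℝ)
    (x : EuclideanSpace ℝ (Fin n)) : Fin n ⊕ Fin q → ℝ :=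
  Sum.elim (fun i => x i) (fun k => ψ k x)

/-- The lifted state `Φ(x) = (1, x, ψ(x)) ∈ ℝᴺ⁺¹`. -/
def lift {n q : ℕ} (ψ : Fin q → EuclideanSpace ℝ (Fin n) → ℝ)
    (x : EuclideanSpace ℝ (Fin n)) : Fin 1 ⊕ (Fin n ⊕ Fin q) → ℝ :=
  Sum.elim (fun _ => 1) (liftHat ψ x)

/-- The space `𝕍` of functions spanned by the observables. -/
def dictionary {n q : ℕ} (ψ : Fin q → EuclideanSpace ℝ (Fin n) → ℝ) :
    Submodule ℝ (EuclideanSpace ℝ (Fin n) → ℝ) :=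
  Submodule.span ℝ (range fun k x => lift ψ x k)

/-- Invariance of the dictionary `𝕍`: for every `φ ∈ 𝕍`, every constant input `u ∈ U` and every
time `t ≥ 0`, the function `x₀ ↦ φ(x(t; x₀, u))` on `X` belongs to `𝕍`. -/
def InvariantDictionary {n q : ℕ} (f g : EuclideanSpace ℝ (Fin n) → EuclideanSpace ℝ (Fin n))
    (X : Set (EuclideanSpace ℝ (Fin n))) (U : Set ℝ)
    (ψ : Fin q → EuclideanSpace ℝ (Fin n) → ℝ) : Prop :=
  ∀ φ ∈ dictionary ψ, ∀ u ∈ U, ∀ t ∈ Ici (0 : ℝ), ∃ φt ∈ dictionary ψ,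
    ∀ x₀ ∈ X, ∀ x : ℝ → EuclideanSpace ℝ (Fin n),
      IsSolution (fun y => f y + u • g y) x₀ x → φ (x t) = φt x₀

/-! ### Data matrices and generator EDMD -/

/-- The matrix with columns `Φ̂(x_j)`. -/
def dataHat {n q d : ℕ} (ψ : Fin q → EuclideanSpace ℝ (Fin n) → ℝ)
    (x : Fin d → EuclideanSpace ℝ (Fin n)) : Matrix (Fin n ⊕ Fin q) (Fin d) ℝ :=
  Matrix.of fun k j => liftHat ψ (x j) k

/-- The matrix with columns `Φ(x_j)`. -/
def dataFull {n q d : ℕ} (ψ : Fin q → EuclideanSpace ℝ (Fin n) → ℝ)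
    (x : Fin d → EuclideanSpace ℝ (Fin n)) : Matrix (Fin 1 ⊕ (Fin n ⊕ Fin q)) (Fin d) ℝ :=
  Matrix.of fun k j => lift ψ (x j) k

/-- The matrix with entries `⟨∇φ_k(x_j), ẋ_j⟩`, `k = 1, …, N`, where `ẋ_j = F(x_j)`. -/
noncomputable def dataDeriv {n q d : ℕ} (ψ : Fin q → EuclideanSpace ℝ (Fin n) → ℝ)
    (F : EuclideanSpace ℝ (Fin n) → EuclideanSpace ℝ (Fin n))
    (x : Fin d → EuclideanSpace ℝ (Fin n)) : Matrix (Fin n ⊕ Fin q) (Fin d) ℝ :=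
  Matrix.of fun k j => fderiv ℝ (fun y => liftHat ψ y k) (x j) (F (x j))

section Frobenius

attribute [local instance] Matrix.frobeniusNormedAddCommGroup

/-- `A` minimizes the Frobenius norm `‖Y - A X‖`. -/
def IsLeastSquares {k l d : Type*} [Fintype k] [Fintype l] [Fintype d]
    (Y : Matrix k d ℝ) (X : Matrix l d ℝ) (A : Matrix k l ℝ) : Prop :=
  ∀ A' : Matrix k l ℝ, ‖Y - A * X‖ ≤ ‖Y - A' * X‖

end Frobenius

/-- `A`, `B₀`, `B₁` are the matrices of the lifted bilinear surrogate obtained by generator EDMD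
from samples `x⁰` for the input `u = 0` and samples `x¹` for the input `u = 1`:
`A` and `[B₀ B̂]` solve the two least-squares problems, and `B₁ = B̂ - A`. -/
def IsEDMD {n q d0 d1 : ℕ} (f g : EuclideanSpace ℝ (Fin n) → EuclideanSpace ℝ (Fin n))
    (ψ : Fin q → EuclideanSpace ℝ (Fin n) → ℝ)
    (x0 : Fin d0 → EuclideanSpace ℝ (Fin n)) (x1 : Fin d1 → EuclideanSpace ℝ (Fin n))
    (A : Matrix (Fin n ⊕ Fin q) (Fin n ⊕ Fin q) ℝ) (B0 : Matrix (Fin n ⊕ Fin q) (Fin 1) ℝ)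
    (B1 : Matrix (Fin n ⊕ Fin q) (Fin n ⊕ Fin q) ℝ) : Prop :=
  IsLeastSquares (dataDeriv ψ f x0) (dataHat ψ x0) A ∧
  ∃ Bhat : Matrix (Fin n ⊕ Fin q) (Fin n ⊕ Fin q) ℝ,
    IsLeastSquares (dataDeriv ψ (fun y => f y + g y) x1) (dataFull ψ x1)
      (Matrix.fromCols B0 Bhat) ∧
    B1 = Bhat - A

/-! ### The linear matrix inequalities -/

section LMI

variable {ι : Type*} [Fintype ι] [DecidableEq ι]

/-- The matrix `[Q S; Sᵀ R]` describing the ellipsoidal set `Δ_Φ`. -/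
def multiplier (Q : Matrix ι ι ℝ) (S : Matrix ι (Fin 1) ℝ) (R : ℝ) :
    Matrix (ι ⊕ Fin 1) (ι ⊕ Fin 1) ℝ :=
  Matrix.fromBlocks Q S Sᵀ !![R]

/-- The matrix of the robust-stability LMI. The blocks `Q̃`, `S̃`, `R̃` are those of
`[Q S; Sᵀ R]⁻¹`. Block rows and columns have sizes `N`, `1`, `N + 1`, `N`. -/
noncomputable def stabilityMatrix (A : Matrix ι ι ℝ) (B0 : Matrix ι (Fin 1) ℝ)
    (B1 : Matrix ι ι ℝ) (Q : Matrix ι ι ℝ) (S : Matrix ι (Fin 1) ℝ) (R c : ℝ)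
    (P : Matrix ι ι ℝ) (L : Matrix (Fin 1) ι ℝ) (lam τ : ℝ) :
    Matrix ((ι ⊕ Fin 1) ⊕ ((ι ⊕ Fin 1) ⊕ ι)) ((ι ⊕ Fin 1) ⊕ ((ι ⊕ Fin 1) ⊕ ι)) ℝ :=
  let Qt : Matrix ι ι ℝ := (multiplier Q S R)⁻¹.toBlocks₁₁
  let St : Matrix ι (Fin 1) ℝ := (multiplier Q S R)⁻¹.toBlocks₁₂
  let Rt : Matrix (Fin 1) (Fin 1) ℝ := (multiplier Q S R)⁻¹.toBlocks₂₂
  let M11 : Matrix (ι ⊕ Fin 1) (ι ⊕ Fin 1) ℝ :=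
    Matrix.fromBlocks
      (-(A * P) - B0 * L - P * Aᵀ - Lᵀ * B0ᵀ - τ • (1 : Matrix ι ι ℝ)) (-Lᵀ - lam • (B1 * St))
      (-L - lam • (Stᵀ * B1ᵀ)) (lam • Rt)
  let M12 : Matrix (ι ⊕ Fin 1) ((ι ⊕ Fin 1) ⊕ ι) ℝ :=
    Matrix.fromBlocks
      (-(Matrix.fromCols P Lᵀ)) (lam • B1)
      0 0
  let M22 : Matrix ((ι ⊕ Fin 1) ⊕ ι) ((ι ⊕ Fin 1) ⊕ ι) ℝ :=
    Matrix.fromBlocks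
      ((τ / (2 * c ^ 2)) • (1 : Matrix (ι ⊕ Fin 1) (ι ⊕ Fin 1) ℝ)) 0
      0 (-(lam • Qt⁻¹))
  Matrix.fromBlocks M11 M12 M12ᵀ M22

/-- The matrix of the LMI for the inclusion of the ellipsoid `{v | vᵀ P⁻¹ v ≤ 1}` in `Δ_Φ`.
Block rows and columns have sizes `N`, `1`, `N`, `1`. -/
noncomputable def inclusionMatrix (Q : Matrix ι ι ℝ) (S : Matrix ι (Fin 1) ℝ) (R : ℝ)
    (P : Matrix ι ι ℝ) (ν : ℝ) :
    Matrix ((ι ⊕ Fin 1) ⊕ (ι ⊕ Fin 1)) ((ι ⊕ Fin 1) ⊕ (ι ⊕ Fin 1)) ℝ :=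
  Matrix.fromBlocks
    (Matrix.fromBlocks P (P * S) (Sᵀ * P) !![ν * R]) (Matrix.fromBlocks P 0 0 !![ν])
    (Matrix.fromBlocks P 0 0 !![ν]) (Matrix.fromBlocks (-(ν • Q⁻¹)) 0 0 1)

end LMI

/-! ### The controller and its region of attraction -/

/-- The feedback `μ(x) = L P⁻¹ Φ̂(x)`. -/
noncomputable def feedback {n q : ℕ} (ψ : Fin q → EuclideanSpace ℝ (Fin n) → ℝ)
    (P : Matrix (Fin n ⊕ Fin q) (Fin n ⊕ Fin q) ℝ) (L : Matrix (Fin 1) (Fin n ⊕ Fin q) ℝ)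
    (x : EuclideanSpace ℝ (Fin n)) : ℝ :=
  ((L * P⁻¹) *ᵥ liftHat ψ x) 0

/-- The sublevel set `{x | Φ̂(x)ᵀ P⁻¹ Φ̂(x) ≤ 1}`. -/
def regionOfAttraction {n q : ℕ} (ψ : Fin q → EuclideanSpace ℝ (Fin n) → ℝ)
    (P : Matrix (Fin n ⊕ Fin q) (Fin n ⊕ Fin q) ℝ) : Set (EuclideanSpace ℝ (Fin n)) :=
  {x | liftHat ψ x ⬝ᵥ (P⁻¹ *ᵥ liftHat ψ x) ≤ 1}

end KoopmanFeedback

/-!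
The lifted state `z = Φ̂(x)` obeys an exactly bilinear equation on `X`, which the data recover with
probability close to one; on this event the two linear matrix inequalities make `zᵀ P⁻¹ z` a
Lyapunov function.

*The generator.* For `φ` in the dictionary the difference quotients of `t ↦ φ(x(t; ·, u))` stay, on
`X`, in a finite-dimensional and hence pointwise closed space, so their limit `⟨∇φ, f + u g⟩` is a
combination of the observables (`generator_mem_span`). This expression is affine in `u`, so two
inputs from `U` suffice to reach `u = 1`, even if `1 ∉ U` (`exists_lifted_generators`). The region
of attraction contains `0`; hence `0 ∈ X`, and `f 0 = 0` removes the constant term for `u = 0`.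

*The data.* Both least-squares problems therefore have zero residual, and their solution is the true
generator as soon as the samples determine all linear combinations of the observables
(`fderiv_liftHat_of_isEDMD`). By compactness of the unit sphere of coefficients this holds when
finitely many open sets of positive measure are all visited (`exists_finite_open_sets`), which
happens with probability tending to one (`eventually_le_pi_visits`). The surrogate has no error on
this event, so any error bound `c_r > 0` is met.

*The matrix inequalities.* The inclusion LMI says that `zᵀ P⁻¹ z ≤ 1` implies
`(z, 1)ᵀ [Q S; Sᵀ R] (z, 1) ≥ 0` (`multiplier_form_nonneg`). Dualization turns this into an
inequality for the inverse multiplier (`multiplier_inv_form_nonpos`), and the stability LMI at a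
suitable vector then gives `d/dt zᵀ P⁻¹ z ≤ -τ |P⁻¹ z|²` (`lyapunov_decrease`).

*The closed loop.* Nothing is known about `f` and `g` off `X`, but on `X` they agree with `C¹`
fields, because the coordinates are observables. Strict decrease on the boundary of the sublevel set
keeps every solution inside, so replacing the closed loop by a compactly supported `C¹` field
changes nothing, which gives existence and uniqueness (`exponentiallyStableOn_of_lyapunov`).
-/

namespace KoopmanFeedback

/-! ### Quadratic forms of block matrices -/

section LMI

variable {ι : Type*} [Fintype ι]

lemma dotProduct_fromBlocks_mulVec {m k m' k' : Type*} [Fintype m] [Fintype k] [Fintype m']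
    [Fintype k'] (A : Matrix m m' ℝ) (B : Matrix m k' ℝ) (C : Matrix k m' ℝ) (D : Matrix k k' ℝ)
    (u : m → ℝ) (v : k → ℝ) (u' : m' → ℝ) (v' : k' → ℝ) :
    Sum.elim u v ⬝ᵥ (Matrix.fromBlocks A B C D *ᵥ Sum.elim u' v') =
      u ⬝ᵥ (A *ᵥ u') + u ⬝ᵥ (B *ᵥ v') + (v ⬝ᵥ (C *ᵥ u') + v ⬝ᵥ (D *ᵥ v')) := by
  simp [Matrix.fromBlocks_mulVec, sumElim_dotProduct_sumElim, dotProduct_add]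

lemma dotProduct_transpose_mulVec {m k : Type*} [Fintype m] [Fintype k]
    (M : Matrix m k ℝ) (u : k → ℝ) (v : m → ℝ) : u ⬝ᵥ (Mᵀ *ᵥ v) = v ⬝ᵥ (M *ᵥ u) := by
  rw [Matrix.mulVec_transpose, dotProduct_comm, ← Matrix.dotProduct_mulVec]

lemma dotProduct_fin_one (c : ℝ) (w : Fin 1 → ℝ) : (fun _ : Fin 1 => c) ⬝ᵥ w = c * w 0 := by
  simp [dotProduct]

lemma mulVec_fin_one {m : Type*} (M : Matrix m (Fin 1) ℝ) (w : Fin 1 → ℝ) :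
    M *ᵥ w = w 0 • M.col 0 := by
  ext i
  simp [Matrix.mulVec, dotProduct, mul_comm, Matrix.col]

lemma transpose_mulVec_zero (M : Matrix ι (Fin 1) ℝ) (v : ι → ℝ) :
    (Mᵀ *ᵥ v) 0 = v ⬝ᵥ M.col 0 := by
  rw [dotProduct_comm]
  rfl

lemma transpose_eq_of_isHermitian {ι : Type*} {M : Matrix ι ι ℝ} (h : M.IsHermitian) : Mᵀ = M := by
  simpa [Matrix.IsHermitian, Matrix.conjTranspose_eq_transpose_of_trivial] using h

lemma mulVec_dotProduct_comm {M : Matrix ι ι ℝ} (h : M.IsHermitian) (u v : ι → ℝ) :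
    u ⬝ᵥ (M *ᵥ v) = v ⬝ᵥ (M *ᵥ u) := by
  conv_lhs => rw [← transpose_eq_of_isHermitian h]
  exact dotProduct_transpose_mulVec M u v

variable [DecidableEq ι]

lemma isHermitian_of_posDef_neg {ι : Type*} {Q : Matrix ι ι ℝ} (hQ : (-Q).PosDef) :
    Q.IsHermitian := by
  simpa using hQ.isHermitian.neg

/-- The inclusion LMI, evaluated at the vector that minimizes its quadratic form over the last
two blocks, says that the ellipsoid `zᵀ P⁻¹ z ≤ 1` lies in the set described by the multiplier. -/
lemma multiplier_form_nonneg {Q : Matrix ι ι ℝ} {S : Matrix ι (Fin 1) ℝ} {R : ℝ}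
    {P : Matrix ι ι ℝ} {ν : ℝ} (hQ : (-Q).PosDef) (hP : P.PosDef) (hν : 0 < ν)
    (h : (inclusionMatrix Q S R P ν).PosSemidef) {z : ι → ℝ} (hz : z ⬝ᵥ (P⁻¹ *ᵥ z) ≤ 1) :
    0 ≤ z ⬝ᵥ (Q *ᵥ z) + 2 * (z ⬝ᵥ S.col 0) + R := by
  have hPu : IsUnit P.det := (Matrix.isUnit_iff_isUnit_det _).1 hP.isUnit
  have hQu : IsUnit Q.det := by
    have := hQ.isUnit
    rw [IsUnit.neg_iff] at this
    exact (Matrix.isUnit_iff_isUnit_det _).1 this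
  set p := P⁻¹ *ᵥ z with hp
  have hPp : P *ᵥ p = z := by
    rw [hp, Matrix.mulVec_mulVec, Matrix.mul_nonsing_inv _ hPu, Matrix.one_mulVec]
  have hQQ : Q⁻¹ *ᵥ (Q *ᵥ z) = z := by
    rw [Matrix.mulVec_mulVec, Matrix.nonsing_inv_mul _ hQu, Matrix.one_mulVec]
  have key := h.dotProduct_mulVec_nonneg
    (Sum.elim (Sum.elim (ν • p) (fun _ : Fin 1 => 1)) (Sum.elim (Q *ᵥ z) (fun _ : Fin 1 => -ν)))
  simp only [star_trivial, inclusionMatrix, dotProduct_fromBlocks_mulVec, Matrix.zero_mulVec,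
    dotProduct_zero, Matrix.one_mulVec, Matrix.mulVec_smul, hPp, ← Matrix.mulVec_mulVec,
    Matrix.neg_mulVec, Matrix.smul_mulVec, hQQ, dotProduct_fin_one, smul_dotProduct,
    dotProduct_smul, dotProduct_neg, smul_eq_mul, mulVec_fin_one S,
    mulVec_dotProduct_comm hP.isHermitian p, mulVec_fin_one !![_], transpose_mulVec_zero,
    dotProduct_comm (Q *ᵥ z) z, dotProduct_comm (S.col 0) z] at key
  have hcol : ∀ a : ℝ, (!![a] : Matrix (Fin 1) (Fin 1) ℝ).col 0 0 = a := fun a => rfl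
  simp only [hcol] at key
  have hz' : z ⬝ᵥ p ≤ 1 := hz
  rw [dotProduct_comm p z] at key
  have : 0 ≤ ν * (z ⬝ᵥ (Q *ᵥ z) + 2 * (z ⬝ᵥ S.col 0) + R) := by nlinarith
  exact nonneg_of_mul_nonneg_right this hν

/-- The multiplier matrix is nonsingular because `Q ≺ 0 < R`. -/
lemma isUnit_det_multiplier {Q : Matrix ι ι ℝ} (S : Matrix ι (Fin 1) ℝ) {R : ℝ}
    (hQ : (-Q).PosDef) (hR : 0 < R) : IsUnit (multiplier Q S R).det := by
  rw [← Matrix.isUnit_iff_isUnit_det, ← Matrix.mulVec_injective_iff_isUnit, ← Matrix.coe_mulVecLin,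
    injective_iff_map_eq_zero]
  intro y hy
  obtain ⟨y₁, y₂, rfl⟩ : ∃ y₁ y₂, y = Sum.elim y₁ y₂ := ⟨_, _, (Sum.elim_comp_inl_inr y).symm⟩
  rw [Matrix.mulVecLin_apply] at hy
  -- pairing the kernel equation with `(y₁, -y₂)` leaves `y₁ᵀ Q y₁ - R y₂² = 0`
  have h1 : Sum.elim y₁ (-y₂) ⬝ᵥ (multiplier Q S R *ᵥ Sum.elim y₁ y₂) = 0 := by
    rw [hy, dotProduct_zero]
  simp only [multiplier, dotProduct_fromBlocks_mulVec, neg_dotProduct,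
    dotProduct_transpose_mulVec, mulVec_fin_one !![_], dotProduct_smul, smul_eq_mul] at h1
  have h2 : y₂ ⬝ᵥ (!![R] : Matrix (Fin 1) (Fin 1) ℝ).col 0 = y₂ 0 * R := by
    simp [dotProduct, Matrix.col]
  rw [h2] at h1
  have h3 : y₁ = 0 := by
    by_contra hne
    have := hQ.dotProduct_mulVec_pos hne
    rw [star_trivial, Matrix.neg_mulVec, dotProduct_neg] at this
    nlinarith [mul_nonneg hR.le (mul_self_nonneg (y₂ 0))]
  have h4 : y₂ 0 = 0 := by
    subst h3
    simpa [hR.ne'] using h1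
  have h5 : y₂ = 0 := by
    ext i
    rw [Subsingleton.elim i 0]
    exact h4
  rw [h3, h5, Sum.elim_zero_zero]

/-- Dualization: if the quadratic form of the multiplier is nonnegative at `(z, 1)`, then the
quadratic form of its inverse is nonpositive at every vector `(b, -zᵀb)` orthogonal to `(z, 1)`,
because `Q ≺ 0` leaves room for a single positive direction. -/
lemma multiplier_inv_form_nonpos {Q : Matrix ι ι ℝ} {S : Matrix ι (Fin 1) ℝ} {R : ℝ}
    (hQ : (-Q).PosDef) (hR : 0 < R) {z : ι → ℝ}
    (hz : 0 ≤ z ⬝ᵥ (Q *ᵥ z) + 2 * (z ⬝ᵥ S.col 0) + R) (b : ι → ℝ) :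
    b ⬝ᵥ ((multiplier Q S R)⁻¹.toBlocks₁₁ *ᵥ b)
      - 2 * (z ⬝ᵥ b) * (b ⬝ᵥ (multiplier Q S R)⁻¹.toBlocks₁₂.col 0)
      + (z ⬝ᵥ b) ^ 2 * (multiplier Q S R)⁻¹.toBlocks₂₂ 0 0 ≤ 0 := by
  set W := multiplier Q S R with hW
  have hWs : Wᵀ = W := by
    rw [hW, multiplier, Matrix.fromBlocks_transpose, Matrix.transpose_transpose,
      transpose_eq_of_isHermitian (isHermitian_of_posDef_neg hQ)]
    congr 1
    ext i j
    simp [Subsingleton.elim i j]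
  have hWis : (W⁻¹)ᵀ = W⁻¹ := by rw [Matrix.transpose_nonsing_inv, hWs]
  have h21 : W⁻¹.toBlocks₂₁ = W⁻¹.toBlocks₁₂ᵀ := by
    ext i j
    simpa [Matrix.toBlocks₂₁, Matrix.toBlocks₁₂] using
      (congrFun (congrFun hWis (Sum.inr i)) (Sum.inl j)).symm
  set v : ι ⊕ Fin 1 → ℝ := Sum.elim b (fun _ => -(z ⬝ᵥ b)) with hv
  have hform : v ⬝ᵥ (W⁻¹ *ᵥ v) = b ⬝ᵥ (W⁻¹.toBlocks₁₁ *ᵥ b)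
      - 2 * (z ⬝ᵥ b) * (b ⬝ᵥ W⁻¹.toBlocks₁₂.col 0) + (z ⬝ᵥ b) ^ 2 * W⁻¹.toBlocks₂₂ 0 0 := by
    conv_lhs => rw [← Matrix.fromBlocks_toBlocks W⁻¹]
    rw [hv, dotProduct_fromBlocks_mulVec, h21, dotProduct_transpose_mulVec]
    simp only [mulVec_fin_one, dotProduct_fin_one, dotProduct_smul, smul_eq_mul]
    simp only [Matrix.col, Matrix.transpose_apply]
    ring
  rw [← hform]
  obtain ⟨y₁, y₂, hy⟩ : ∃ y₁ y₂, W⁻¹ *ᵥ v = Sum.elim y₁ y₂ :=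
    ⟨_, _, (Sum.elim_comp_inl_inr _).symm⟩
  have hWy : W *ᵥ Sum.elim y₁ y₂ = v := by
    rw [← hy, Matrix.mulVec_mulVec, Matrix.mul_nonsing_inv _ (isUnit_det_multiplier S hQ hR),
      Matrix.one_mulVec]
  -- with `y = W⁻¹ v`, write `y = y₂ (z, 1) + (x, 0)`; then `(z, 1)ᵀ W y = 0` gives
  -- `yᵀ W y = xᵀ Q x - y₂² (z, 1)ᵀ W (z, 1)`
  set x := y₁ - y₂ 0 • z with hx
  have hcol : ∀ a : ℝ, (!![a] : Matrix (Fin 1) (Fin 1) ℝ).col 0 0 = a := fun a => rfl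
  have hy₂ : y₂ = fun _ => y₂ 0 := by
    ext i
    rw [Subsingleton.elim i 0]
  have hy₁ : y₁ = x + y₂ 0 • z := by rw [hx]; abel
  have horth : Sum.elim z (fun _ : Fin 1 => 1) ⬝ᵥ (W *ᵥ Sum.elim y₁ y₂) = 0 := by
    rw [hWy, hv, sumElim_dotProduct_sumElim, dotProduct_fin_one]
    ring
  have hself : v ⬝ᵥ (W⁻¹ *ᵥ v) = Sum.elim y₁ y₂ ⬝ᵥ (W *ᵥ Sum.elim y₁ y₂) := by
    rw [hy, hWy, dotProduct_comm]
  have hxQ : x ⬝ᵥ (Q *ᵥ x) ≤ 0 := by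
    have := hQ.posSemidef.dotProduct_mulVec_nonneg x
    rw [star_trivial, Matrix.neg_mulVec, dotProduct_neg] at this
    linarith
  have hsymm := mulVec_dotProduct_comm (isHermitian_of_posDef_neg hQ) z x
  rw [hself]
  rw [hy₁, hy₂] at horth ⊢
  simp only [hW, multiplier, dotProduct_fromBlocks_mulVec, dotProduct_transpose_mulVec,
    mulVec_fin_one, dotProduct_fin_one, dotProduct_smul, smul_dotProduct, smul_eq_mul,
    hcol, Matrix.mulVec_add, Matrix.mulVec_smul, dotProduct_add, add_dotProduct,
    hsymm] at horth ⊢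
  have h1 := mul_nonneg (sq_nonneg (y₂ 0)) hz
  have h2 := congrArg (y₂ 0 * ·) horth
  simp only [mul_zero] at h2
  linarith

/-- Along the lifted closed loop `ż = A z + (B₀ + B₁ z) L P⁻¹ z` the derivative of `zᵀ P⁻¹ z`,
written with `p = P⁻¹ z`, is at most `-τ ‖p‖²`. -/
lemma lyapunov_decrease {A : Matrix ι ι ℝ} {B0 : Matrix ι (Fin 1) ℝ} {B1 : Matrix ι ι ℝ}
    {Q : Matrix ι ι ℝ} {S : Matrix ι (Fin 1) ℝ} {R c : ℝ} {P : Matrix ι ι ℝ}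
    {L : Matrix (Fin 1) ι ℝ} {lam τ : ℝ} (hQ : (-Q).PosDef) (hR : 0 < R) (hP : P.PosDef)
    (hlam : 0 < lam) (h : (stabilityMatrix A B0 B1 Q S R c P L lam τ).PosDef) {p z : ι → ℝ}
    (hp : P *ᵥ p = z) (hz : 0 ≤ z ⬝ᵥ (Q *ᵥ z) + 2 * (z ⬝ᵥ S.col 0) + R) :
    2 * (p ⬝ᵥ (A *ᵥ z + (L *ᵥ p) 0 • (B0.col 0 + B1 *ᵥ z))) ≤ -τ * (p ⬝ᵥ p) := by
  set Wi := (multiplier Q S R)⁻¹ with hWi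
  set b := B1ᵀ *ᵥ p with hb
  set r := Wi.toBlocks₁₁ *ᵥ b with hr
  have hdual := multiplier_inv_form_nonpos hQ hR hz b
  rw [← hWi] at hdual
  have hr1 : r ⬝ᵥ (Wi.toBlocks₁₁⁻¹ *ᵥ r) = b ⬝ᵥ (Wi.toBlocks₁₁ *ᵥ b) := by
    -- `Q̃` is nonsingular because `-λ Q̃⁻¹` is a diagonal block of a positive definite matrix
    have h1 : (-(lam • Wi.toBlocks₁₁⁻¹)).PosDef :=
      h.submatrix (e := fun i => Sum.inr (Sum.inr i))
        (Sum.inr_injective.comp Sum.inr_injective)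
    have h2 : IsUnit (Wi.toBlocks₁₁⁻¹).det := by
      have := (Matrix.isUnit_iff_isUnit_det _).1 h1.isUnit
      rw [← neg_smul, Matrix.det_smul] at this
      exact isUnit_of_mul_isUnit_right this
    rw [hr, Matrix.mulVec_mulVec b, Matrix.nonsing_inv_mul _
      (Matrix.isUnit_nonsing_inv_det_iff.1 h2), Matrix.one_mulVec, dotProduct_comm]
  have hB1 : ∀ w, p ⬝ᵥ (B1 *ᵥ w) = b ⬝ᵥ w := fun w => by
    rw [hb, dotProduct_comm (B1ᵀ *ᵥ p), dotProduct_transpose_mulVec]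
  have hPA : p ⬝ᵥ (P *ᵥ (Aᵀ *ᵥ p)) = p ⬝ᵥ (A *ᵥ z) := by
    rw [mulVec_dotProduct_comm hP.isHermitian, hp, dotProduct_comm, dotProduct_transpose_mulVec]
  have hLp : p ⬝ᵥ Lᵀ.col 0 = (L *ᵥ p) 0 := by
    rw [← transpose_mulVec_zero, Matrix.transpose_transpose]
  -- this `r` minimizes the quadratic form over the last block; the entry `zᵀ b` makes
  -- `(b, -zᵀ b)` orthogonal to `(z, 1)`, so that dualization applies
  have key := h.posSemidef.dotProduct_mulVec_nonneg
    (Sum.elim (Sum.elim p (fun _ : Fin 1 => z ⬝ᵥ b)) (Sum.elim (Sum.elim 0 0) r))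
  simp only [star_trivial, stabilityMatrix, dotProduct_fromBlocks_mulVec, ← hWi,
    Matrix.fromBlocks_transpose, Matrix.transpose_zero, Matrix.zero_mulVec, dotProduct_zero,
    Matrix.one_mulVec, Matrix.neg_mulVec, Matrix.smul_mulVec, dotProduct_fin_one, dotProduct_smul,
    dotProduct_neg, smul_eq_mul, Matrix.sub_mulVec, dotProduct_sub, Sum.elim_zero_zero,
    Matrix.mulVec_zero, zero_dotProduct, Matrix.transpose_smul, dotProduct_transpose_mulVec,
    ← Matrix.mulVec_mulVec, hp, mulVec_fin_one B0, mulVec_fin_one Lᵀ,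
    mulVec_fin_one (Matrix.toBlocks₁₂ _), mulVec_fin_one (Matrix.toBlocks₂₂ _), hr1, hPA, hB1, hLp,
    transpose_mulVec_zero] at key
  have hcol : Wi.toBlocks₂₂.col 0 0 = Wi.toBlocks₂₂ 0 0 := rfl
  rw [hcol, ← hb, ← hr] at key
  have hbr : b ⬝ᵥ (Wi.toBlocks₁₁ *ᵥ b) = b ⬝ᵥ r := rfl
  have h1 := mul_nonpos_of_nonneg_of_nonpos hlam.le hdual
  rw [hbr] at key h1
  rw [dotProduct_add, dotProduct_smul, dotProduct_add, hB1, smul_eq_mul, dotProduct_comm b z]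
  linarith

end LMI

/-! ### The generator on an invariant dictionary -/

open Filter Topology in
/-- The difference quotients `(φ(x(t; ·, u)) - φ) / t` lie in the span of the observables on `X`,
which is finite-dimensional and hence closed under pointwise limits; so their limit, the generator
applied to `φ`, lies in the span as well. -/
lemma generator_mem_span {n q : ℕ} {f g : EuclideanSpace ℝ (Fin n) → EuclideanSpace ℝ (Fin n)}
    {X : Set (EuclideanSpace ℝ (Fin n))} {U : Set ℝ}
    {ψ : Fin q → EuclideanSpace ℝ (Fin n) → ℝ} {u : ℝ} (hu : u ∈ U)
    (hwp : WellPosedOn (fun y => f y + u • g y) X) (hinv : InvariantDictionary f g X U ψ)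
    {φ : EuclideanSpace ℝ (Fin n) → ℝ} (hφ : φ ∈ dictionary ψ) (hd : Differentiable ℝ φ) :
    ∃ a : Fin 1 ⊕ (Fin n ⊕ Fin q) → ℝ, ∀ x ∈ X,
      fderiv ℝ φ x (f x + u • g x) = a ⬝ᵥ lift ψ x := by
  let res : (EuclideanSpace ℝ (Fin n) → ℝ) →ₗ[ℝ] (X → ℝ) := LinearMap.funLeft ℝ ℝ Subtype.val
  let D : Submodule ℝ (X → ℝ) := (dictionary ψ).map res
  have hfin : FiniteDimensional ℝ (dictionary ψ) :=
    FiniteDimensional.span_of_finite ℝ (finite_range _)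
  have hclosed : IsClosed (D : Set (X → ℝ)) := D.closed_of_finiteDimensional
  choose sol hsol _ using hwp
  choose! φt hφt hφt' using hinv φ hφ u hu
  have hlim : Tendsto (fun t : ℝ => t⁻¹ • (res (φt t) - res φ)) (𝓝[>] 0)
      (𝓝 fun x : X => fderiv ℝ φ x (f x + u • g x)) := by
    rw [tendsto_pi_nhds]
    intro x
    have h1 := (hsol x x.2).2 0 self_mem_Ici
    have hx0 := (hsol x x.2).1
    have h2 : HasDerivWithinAt (φ ∘ sol x x.2) (fderiv ℝ φ x (f x + u • g x)) (Ioi 0) 0 := by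
      have := ((hd (sol x x.2 0)).hasFDerivAt.comp_hasDerivWithinAt (0 : ℝ) h1)
      rw [hx0] at this
      exact this.mono Ioi_subset_Ici_self
    rw [hasDerivWithinAt_iff_tendsto_slope' self_notMem_Ioi] at h2
    refine h2.congr' ?_
    filter_upwards [self_mem_nhdsWithin] with t ht
    have := hφt' t (mem_Ici.2 (le_of_lt ht))  x x.2 _ (hsol x x.2)
    simp [slope, this, hx0, res, LinearMap.funLeft]
  have hmem : (fun x : X => fderiv ℝ φ x (f x + u • g x)) ∈ D := by
    refine hclosed.mem_of_tendsto hlim ?_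
    filter_upwards [self_mem_nhdsWithin] with t ht
    exact D.smul_mem _ (D.sub_mem ⟨_, hφt t (mem_Ici.2 (le_of_lt ht)), rfl⟩ ⟨_, hφ, rfl⟩)
  obtain ⟨χ, hχ, hχ'⟩ := hmem
  obtain ⟨a, ha⟩ := (Submodule.mem_span_range_iff_exists_fun ℝ).1 hχ
  refine ⟨a, fun x hx => ?_⟩
  have := congrFun hχ' ⟨x, hx⟩
  simp only [res, LinearMap.funLeft_apply] at this
  rw [← this, ← ha]
  simp [dotProduct]

lemma contDiff_liftHat_apply {n q : ℕ} {ψ : Fin q → EuclideanSpace ℝ (Fin n) → ℝ}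
    (hψ : ∀ k, ContDiff ℝ 2 (ψ k)) (k : Fin n ⊕ Fin q) :
    ContDiff ℝ 2 fun x => liftHat ψ x k := by
  rcases k with i | k
  · simp only [liftHat, Sum.elim_inl]
    fun_prop
  · exact hψ k

lemma contDiff_liftHat {n q : ℕ} {ψ : Fin q → EuclideanSpace ℝ (Fin n) → ℝ}
    (hψ : ∀ k, ContDiff ℝ 2 (ψ k)) : ContDiff ℝ 2 (liftHat ψ) :=
  contDiff_pi.2 (contDiff_liftHat_apply hψ)

lemma continuous_lift {n q : ℕ} {ψ : Fin q → EuclideanSpace ℝ (Fin n) → ℝ}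
    (hψ : ∀ k, ContDiff ℝ 2 (ψ k)) : Continuous (lift ψ) := by
  refine continuous_pi fun k => ?_
  rcases k with i | k
  · exact continuous_const
  · exact (contDiff_liftHat_apply hψ k).continuous

lemma liftHat_zero {n q : ℕ} {ψ : Fin q → EuclideanSpace ℝ (Fin n) → ℝ}
    (hψ0 : ∀ k, ψ k 0 = 0) : liftHat ψ 0 = 0 := by
  ext k
  rcases k with i | k
  · rfl
  · exact hψ0 k

lemma liftHat_mem_dictionary {n q : ℕ} (ψ : Fin q → EuclideanSpace ℝ (Fin n) → ℝ)
    (k : Fin n ⊕ Fin q) : (fun x => liftHat ψ x k) ∈ dictionary ψ :=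
  Submodule.subset_span ⟨Sum.inr k, rfl⟩

lemma fderiv_liftHat_inl {n q : ℕ} (ψ : Fin q → EuclideanSpace ℝ (Fin n) → ℝ) (i : Fin n)
    (x v : EuclideanSpace ℝ (Fin n)) :
    fderiv ℝ (fun y => liftHat ψ y (Sum.inl i)) x v = v i := by
  have : (fun y => liftHat ψ y (Sum.inl i)) = ⇑(EuclideanSpace.proj (𝕜 := ℝ) i) := rfl
  rw [this, ContinuousLinearMap.fderiv]
  rfl

/-- The generator of the input `u = 1` maps the observables into the dictionary even if `1 ∉ U`,
because the generator is affine in `u` and `U` contains two distinct inputs. -/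
lemma exists_lifted_generators {n q : ℕ}
    {f g : EuclideanSpace ℝ (Fin n) → EuclideanSpace ℝ (Fin n)} (hf0 : f 0 = 0)
    {X : Set (EuclideanSpace ℝ (Fin n))} (h0X : 0 ∈ X) {U : Set ℝ} (hU0 : (0 : ℝ) ∈ interior U)
    (hwp : ∀ u ∈ U, WellPosedOn (fun y => f y + u • g y) X)
    {ψ : Fin q → EuclideanSpace ℝ (Fin n) → ℝ} (hψ : ∀ k, ContDiff ℝ 2 (ψ k))
    (hψ0 : ∀ k, ψ k 0 = 0) (hinv : InvariantDictionary f g X U ψ) :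
    ∃ (A : Matrix (Fin n ⊕ Fin q) (Fin n ⊕ Fin q) ℝ)
      (B : Matrix (Fin n ⊕ Fin q) (Fin 1 ⊕ (Fin n ⊕ Fin q)) ℝ), ∀ x ∈ X, ∀ k,
        fderiv ℝ (fun y => liftHat ψ y k) x (f x) = (A *ᵥ liftHat ψ x) k ∧
        fderiv ℝ (fun y => liftHat ψ y k) x (f x + g x) = (B *ᵥ lift ψ x) k := by
  obtain ⟨ε, hε, hεU⟩ : ∃ ε : ℝ, 0 < ε ∧ ε ∈ U := by
    obtain ⟨r, hr, hrU⟩ := Metric.mem_nhds_iff.1 (mem_interior_iff_mem_nhds.1 hU0)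
    exact ⟨r / 2, by positivity, hrU (by simp [abs_of_pos hr, hr])⟩
  have hd : ∀ k, Differentiable ℝ fun y => liftHat ψ y k := fun k =>
    (contDiff_liftHat_apply hψ k).differentiable (by norm_num)
  have key : ∀ u ∈ U, ∀ k, ∃ a : Fin 1 ⊕ (Fin n ⊕ Fin q) → ℝ, ∀ x ∈ X,
      fderiv ℝ (fun y => liftHat ψ y k) x (f x + u • g x) = a ⬝ᵥ lift ψ x := fun u hu k =>
    generator_mem_span hu (hwp u hu) hinv (liftHat_mem_dictionary ψ k) (hd k)
  choose a ha using key 0 (interior_subset hU0)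
  choose b hb using key ε hεU
  simp only [zero_smul, add_zero] at ha
  -- the constant coefficient of the drift vanishes, since `f 0 = 0` and `Φ̂(0) = 0`
  have ha0 : ∀ k, a k (Sum.inl 0) = 0 := fun k => by
    have := ha k 0 h0X
    simpa [hf0, lift, liftHat_zero hψ0, dotProduct] using this.symm
  refine ⟨Matrix.of fun k l => a k (Sum.inr l),
    Matrix.of fun k => a k + ε⁻¹ • (b k - a k), fun x hx k => ⟨?_, ?_⟩⟩
  · rw [ha k x hx]
    simp [Matrix.mulVec, dotProduct, lift, ha0]
  · have h1 := ha k x hx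
    have h2 := hb k x hx
    rw [map_add, map_smul, h1, smul_eq_mul] at h2
    rw [map_add, h1]
    have h3 : (Matrix.of (fun k => a k + ε⁻¹ • (b k - a k)) *ᵥ lift ψ x) k =
        (a k + ε⁻¹ • (b k - a k)) ⬝ᵥ lift ψ x := rfl
    rw [h3, add_dotProduct, smul_dotProduct, sub_dotProduct, ← h2, smul_eq_mul]
    field_simp
    ring

/-! ### Exact recovery from data -/

/-- If the data are generated by a linear map and excite all directions, then the least-squares
problem has that map as its only solution. -/
lemma eq_of_isLeastSquares {k l d : Type*} [Fintype k] [Fintype l] [Fintype d]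
    {Y : Matrix k d ℝ} {Z : Matrix l d ℝ} {A A' : Matrix k l ℝ} (h : IsLeastSquares Y Z A)
    (hY : Y = A' * Z) (hZ : ∀ a : l → ℝ, a ᵥ* Z = 0 → a = 0) : A = A' := by
  let _ : NormedAddCommGroup (Matrix k d ℝ) := Matrix.frobeniusNormedAddCommGroup
  have h1 : ‖Y - A * Z‖ ≤ ‖Y - A' * Z‖ := h A'
  rw [← hY, sub_self, norm_zero, norm_le_zero_iff, sub_eq_zero, hY] at h1
  have h2 : (A' - A) * Z = 0 := by rw [Matrix.sub_mul, h1, sub_self]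
  ext i j
  have h3 : (A' - A) i = 0 := hZ _ (by
    have := congrFun h2 i
    rwa [Matrix.mul_apply_eq_vecMul] at this)
  have h4 : A' i j - A i j = 0 := congrFun h3 j
  linarith

/-- The surrogate is exact on `X`: the lifted state satisfies a bilinear differential equation with
the matrices computed from data. -/
lemma fderiv_liftHat_of_isEDMD {n q d0 d1 : ℕ}
    {f g : EuclideanSpace ℝ (Fin n) → EuclideanSpace ℝ (Fin n)} (hf0 : f 0 = 0)
    {X : Set (EuclideanSpace ℝ (Fin n))} (h0X : 0 ∈ X) {U : Set ℝ} (hU0 : (0 : ℝ) ∈ interior U)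
    (hwp : ∀ u ∈ U, WellPosedOn (fun y => f y + u • g y) X)
    {ψ : Fin q → EuclideanSpace ℝ (Fin n) → ℝ} (hψ : ∀ k, ContDiff ℝ 2 (ψ k))
    (hψ0 : ∀ k, ψ k 0 = 0) (hinv : InvariantDictionary f g X U ψ)
    {x0 : Fin d0 → EuclideanSpace ℝ (Fin n)} {x1 : Fin d1 → EuclideanSpace ℝ (Fin n)}
    (hx0 : ∀ j, x0 j ∈ X) (hx1 : ∀ j, x1 j ∈ X)
    (hspan0 : ∀ a, (∀ j, a ⬝ᵥ lift ψ (x0 j) = 0) → a = 0)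
    (hspan1 : ∀ a, (∀ j, a ⬝ᵥ lift ψ (x1 j) = 0) → a = 0)
    {A : Matrix (Fin n ⊕ Fin q) (Fin n ⊕ Fin q) ℝ} {B0 : Matrix (Fin n ⊕ Fin q) (Fin 1) ℝ}
    {B1 : Matrix (Fin n ⊕ Fin q) (Fin n ⊕ Fin q) ℝ} (h : IsEDMD f g ψ x0 x1 A B0 B1)
    {x : EuclideanSpace ℝ (Fin n)} (hx : x ∈ X) (u : ℝ) (k : Fin n ⊕ Fin q) :
    fderiv ℝ (fun y => liftHat ψ y k) x (f x + u • g x) =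
      (A *ᵥ liftHat ψ x + u • (B0.col 0 + B1 *ᵥ liftHat ψ x)) k := by
  obtain ⟨A', B', hAB⟩ := exists_lifted_generators hf0 h0X hU0 hwp hψ hψ0 hinv
  obtain ⟨hA, Bhat, hB, rfl⟩ := h
  have hA' : A = A' := by
    refine eq_of_isLeastSquares hA ?_ fun a ha => ?_
    · ext k j
      exact (hAB (x0 j) (hx0 j) k).1
    · have : (Sum.elim 0 a : Fin 1 ⊕ (Fin n ⊕ Fin q) → ℝ) = 0 := hspan0 _ fun j => by
        rw [lift, sumElim_dotProduct_sumElim, zero_dotProduct, zero_add]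
        exact congrFun ha j
      ext k
      exact congrFun this (Sum.inr k)
  have hB' : Matrix.fromCols B0 Bhat = B' := by
    refine eq_of_isLeastSquares hB ?_ fun a ha => hspan1 _ fun j => congrFun ha j
    ext k j
    exact (hAB (x1 j) (hx1 j) k).2
  have h1 := (hAB x hx k).1
  have h2 := (hAB x hx k).2
  rw [← hA'] at h1
  rw [← hB', lift, Matrix.fromCols_mulVec_sumElim, map_add, h1, mulVec_fin_one B0] at h2
  rw [map_add, map_smul, h1]
  simp only [Pi.add_apply, Pi.smul_apply, smul_eq_mul, one_mul, Matrix.sub_mulVec,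
    Pi.sub_apply] at h2 ⊢
  linear_combination u * h2

/-! ### Random samples -/

/-- Finitely many open sets of positive measure such that points that visit all of them determine
every linear combination of the observables: by compactness of the unit sphere of coefficients. -/
lemma exists_finite_open_sets {E κ : Type*} [TopologicalSpace E] [HereditarilyLindelofSpace E]
    [MeasurableSpace E] [Fintype κ] {ρ : Measure E} {Φ : E → κ → ℝ}
    (hΦ : Continuous Φ) (hρ : ∀ a : κ → ℝ, (∀ᵐ x ∂ρ, a ⬝ᵥ Φ x = 0) → a = 0) :
    ∃ T : Set (Set E), T.Finite ∧ (∀ V ∈ T, IsOpen V ∧ 0 < ρ V) ∧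
      ∀ D : Set E, (∀ V ∈ T, (V ∩ D).Nonempty) → ∀ a : κ → ℝ, (∀ x ∈ D, a ⬝ᵥ Φ x = 0) → a = 0 := by
  obtain ⟨T, hT, hTV, hTD⟩ : ∃ T : Set (Set E), T.Finite ∧ (∀ V ∈ T, IsOpen V ∧ 0 < ρ V) ∧
      ∀ D : Set E, (∀ V ∈ T, (V ∩ D).Nonempty) →
        ∀ a ∈ Metric.sphere (0 : κ → ℝ) 1, ∃ x ∈ D, a ⬝ᵥ Φ x ≠ 0 := by
    refine (isCompact_sphere (0 : κ → ℝ) 1).induction_on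
      (p := fun s => ∃ T : Set (Set E), T.Finite ∧ (∀ V ∈ T, IsOpen V ∧ 0 < ρ V) ∧
        ∀ D : Set E, (∀ V ∈ T, (V ∩ D).Nonempty) → ∀ a ∈ s, ∃ x ∈ D, a ⬝ᵥ Φ x ≠ 0)
      ⟨∅, finite_empty, by simp, by simp⟩ ?_ ?_ ?_
    · rintro s t hst ⟨T, hT, hTV, hTD⟩
      exact ⟨T, hT, hTV, fun D hD a ha => hTD D hD a (hst ha)⟩
    · rintro s t ⟨T, hT, hTV, hTD⟩ ⟨T', hT', hTV', hTD'⟩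
      refine ⟨T ∪ T', hT.union hT', fun V hV => hV.elim (hTV V) (hTV' V), fun D hD a ha => ?_⟩
      exact ha.elim (hTD D (fun V hV => hD V (Or.inl hV)) a)
        (hTD' D (fun V hV => hD V (Or.inr hV)) a)
    · intro a ha
      have ha0 : a ≠ 0 := by
        rintro rfl
        simp at ha
      have hpos : 0 < ρ {x | a ⬝ᵥ Φ x ≠ 0} :=
        pos_iff_ne_zero.2 fun h => ha0 (hρ a (ae_iff.2 h))
      obtain ⟨y, hy, hys⟩ := Measure.nonempty_inter_support_of_pos hpos
      have hcont : Continuous fun w : (κ → ℝ) × E => w.1 ⬝ᵥ Φ w.2 := by fun_prop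
      have hnhds : {w : (κ → ℝ) × E | w.1 ⬝ᵥ Φ w.2 ≠ 0} ∈ nhds (a, y) :=
        (isOpen_ne.preimage hcont).mem_nhds hy
      obtain ⟨s, hs, V, hV, hsV⟩ := mem_nhds_prod_iff.1 hnhds
      obtain ⟨V', hV', hVo, hyV'⟩ := mem_nhds_iff.1 hV
      refine ⟨s, mem_nhdsWithin_of_mem_nhds hs, {V'}, finite_singleton _, ?_, ?_⟩
      · rintro _ rfl
        exact ⟨hVo, (Measure.mem_support_iff_forall y).1 hys _ (hVo.mem_nhds hyV')⟩
      · intro D hD b hb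
        obtain ⟨x, hx, hxD⟩ := hD V' rfl
        exact ⟨x, hxD, hsV (mk_mem_prod hb (hV' hx))⟩
  refine ⟨T, hT, hTV, fun D hD a ha => ?_⟩
  by_contra hne
  obtain ⟨x, hx, hxa⟩ := hTD D hD (‖a‖⁻¹ • a) (by simp [norm_smul, hne])
  exact hxa (by rw [smul_dotProduct, ha x hx, smul_zero])

open Filter Topology in
/-- With many independent samples, all given sets of positive measure are visited with probability
close to one: each is missed by `d` samples with probability `ρ(Vᶜ)ᵈ`. -/
lemma eventually_le_pi_visits {E : Type*} [MeasurableSpace E] (ρ : Measure E)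
    [IsProbabilityMeasure ρ] {X : Set E} (hX : MeasurableSet X) (hρX : ρ Xᶜ = 0)
    {T : Set (Set E)} (hT : T.Finite) (hTV : ∀ V ∈ T, MeasurableSet V ∧ 0 < ρ V)
    {δ : ℝ} (hδ : 0 < δ) :
    ∀ᶠ d : ℕ in atTop, ∃ G : Set (Fin d → E), MeasurableSet G ∧
      ENNReal.ofReal (1 - δ) ≤ (Measure.pi fun _ : Fin d => ρ) G ∧
      ∀ s ∈ G, (∀ j, s j ∈ X) ∧ ∀ V ∈ T, (V ∩ range s).Nonempty := by
  have hlt : ∀ V ∈ hT.toFinset, ρ Vᶜ < 1 := fun V hV => by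
    obtain ⟨hm, hp⟩ := hTV V (hT.mem_toFinset.1 hV)
    rw [prob_compl_eq_one_sub hm]
    exact ENNReal.sub_lt_self ENNReal.one_ne_top one_ne_zero hp.ne'
  have hlim : Tendsto (fun d : ℕ => ∑ V ∈ hT.toFinset, ρ Vᶜ ^ d) atTop (𝓝 0) := by
    have := tendsto_finsetSum hT.toFinset fun V hV =>
      ENNReal.tendsto_pow_atTop_nhds_zero_of_lt_one (hlt V hV)
    simpa using this
  have hev := hlim.eventually (gt_mem_nhds (ENNReal.ofReal_pos.2 hδ))
  filter_upwards [hev] with d hd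
  set bad : Set (Fin d → E) :=
    (pi univ fun _ => X)ᶜ ∪ ⋃ V ∈ hT.toFinset, pi univ fun _ => Vᶜ with hbad
  have hmX : MeasurableSet (pi univ fun _ : Fin d => X) := MeasurableSet.univ_pi fun _ => hX
  have hmbad : MeasurableSet bad := hmX.compl.union <|
    Finset.measurableSet_biUnion _ fun V hV => MeasurableSet.univ_pi fun _ =>
      (hTV V (hT.mem_toFinset.1 hV)).1.compl
  have hX1 : ρ X = 1 := (prob_compl_eq_zero_iff hX).1 hρX
  have hμX : (Measure.pi fun _ : Fin d => ρ) (pi univ fun _ => X)ᶜ = 0 := by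
    rw [prob_compl_eq_zero_iff hmX, Measure.pi_pi]
    simp [hX1]
  have hμbad : (Measure.pi fun _ : Fin d => ρ) bad ≤ ENNReal.ofReal δ := by
    calc (Measure.pi fun _ : Fin d => ρ) bad
        ≤ 0 + ∑ V ∈ hT.toFinset, (Measure.pi fun _ : Fin d => ρ) (pi univ fun _ => Vᶜ) :=
          (measure_union_le _ _).trans
            (add_le_add hμX.le (measure_biUnion_finset_le _ _))
      _ = ∑ V ∈ hT.toFinset, ρ Vᶜ ^ d := by simp [Measure.pi_pi]
      _ ≤ ENNReal.ofReal δ := hd.le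
  refine ⟨badᶜ, hmbad.compl, ?_, fun s hs => ?_⟩
  · rw [prob_compl_eq_one_sub hmbad, ENNReal.ofReal_sub _ hδ.le, ENNReal.ofReal_one]
    exact tsub_le_tsub_left hμbad 1
  · simp only [hbad, compl_union, compl_compl, mem_inter_iff, mem_compl_iff, mem_iUnion,
      mem_univ_pi, Finite.mem_toFinset, not_exists, not_forall, not_not] at hs
    refine ⟨hs.1, fun V hV => ?_⟩
    obtain ⟨j, hj⟩ := hs.2 V hV
    exact ⟨s j, hj, j, rfl⟩

/-! ### Global solutions and Lyapunov functions -/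

section ODE

variable {E : Type*} [NormedAddCommGroup E] [NormedSpace ℝ E]

lemma IsSolution.continuousOn {F : E → E} {x₀ : E} {x : ℝ → E} (h : IsSolution F x₀ x) :
    ContinuousOn x (Ici 0) := fun t ht => (h.2 t ht).continuousWithinAt

lemma IsSolution.eqOn_of_lipschitzWith {F : E → E} {K : NNReal} (hF : LipschitzWith K F) {x₀ : E}
    {x y : ℝ → E} (hx : IsSolution F x₀ x) (hy : IsSolution F x₀ y) : EqOn y x (Ici 0) := by
  intro t ht
  refine ODE_solution_unique (v := fun _ => F) (a := 0) (b := t) (fun _ => hF)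
    (hy.continuousOn.mono Icc_subset_Ici_self) (fun s hs => ?_)
    (hx.continuousOn.mono Icc_subset_Ici_self) (fun s hs => ?_) (hy.1.trans hx.1.symm)
    ⟨ht, le_rfl⟩
  · exact (hy.2 s hs.1).mono (Ici_subset_Ici.2 hs.1)
  · exact (hx.2 s hs.1).mono (Ici_subset_Ici.2 hs.1)

/-- A bounded, globally Lipschitz vector field has solutions on `[0, ∞)`: the Picard–Lindelöf
theorem applies on every `[0, m]`, and the solutions agree where they overlap. -/
lemma exists_isSolution_of_lipschitzWith [CompleteSpace E] {F : E → E} {K : NNReal}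
    (hF : LipschitzWith K F) {C : ℝ} (hC : ∀ x, ‖F x‖ ≤ C) (x₀ : E) :
    ∃ x : ℝ → E, IsSolution F x₀ x := by
  have hloc : ∀ m : ℕ, ∃ α : ℝ → E, α 0 = x₀ ∧
      ∀ t ∈ Icc (0 : ℝ) (m + 1), HasDerivWithinAt α (F (α t)) (Icc 0 (m + 1)) t := by
    intro m
    have hm : (0 : ℝ) ≤ m + 1 := by positivity
    have hpl : IsPicardLindelof (fun _ => F) (tmin := 0) (tmax := m + 1) ⟨0, le_rfl, hm⟩ x₀
        (C.toNNReal * (m + 1)) 0 C.toNNReal K :=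
      { lipschitzOnWith := fun _ _ => hF.lipschitzOnWith
        continuousOn := fun _ _ => continuousOn_const
        norm_le := fun _ _ x _ => (hC x).trans (Real.le_coe_toNNReal C)
        mul_max_le := by simp [hm] }
    exact hpl.exists_eq_forall_mem_Icc_hasDerivWithinAt₀
  choose α hα0 hα using hloc
  have hagree : ∀ m k : ℕ, m ≤ k → EqOn (α m) (α k) (Icc 0 (m + 1)) := by
    intro m k hmk
    have hmk' : (m : ℝ) + 1 ≤ k + 1 := by exact_mod_cast Nat.succ_le_succ hmk
    refine ODE_solution_unique (v := fun _ => F) (fun _ => hF)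
      (fun t ht => (hα m t ht).continuousWithinAt) (fun t ht => ?_)
      (fun t ht => ((hα k t ⟨ht.1, ht.2.trans hmk'⟩).mono
        (Icc_subset_Icc_right hmk')).continuousWithinAt) (fun t ht => ?_)
      ((hα0 m).trans (hα0 k).symm)
    · exact (hα m t ⟨ht.1, ht.2.le⟩).mono_of_mem_nhdsWithin
        (Filter.mem_of_superset (Icc_mem_nhdsGE ht.2) (Icc_subset_Icc_left ht.1))
    · have ht2 : t < k + 1 := ht.2.trans_le hmk'
      exact (hα k t ⟨ht.1, ht2.le⟩).mono_of_mem_nhdsWithin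
        (Filter.mem_of_superset (Icc_mem_nhdsGE ht2) (Icc_subset_Icc_left ht.1))
  have hx : ∀ m : ℕ, EqOn (fun t => α ⌊t⌋₊ t) (α m) (Icc 0 (m + 1)) := by
    intro m t ht
    rcases le_total ⌊t⌋₊ m with h | h
    · exact hagree _ _ h ⟨ht.1, (Nat.lt_floor_add_one t).le⟩
    · exact (hagree _ _ h ht).symm
  refine ⟨fun t => α ⌊t⌋₊ t, by simp [hα0], fun t ht => ?_⟩
  have ht' : t < (⌊t⌋₊ : ℝ) + 1 := Nat.lt_floor_add_one t
  have hmem : t ∈ Icc (0 : ℝ) (⌊t⌋₊ + 1) := ⟨ht, ht'.le⟩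
  refine ((hα ⌊t⌋₊ t hmem).congr (hx ⌊t⌋₊) (hx ⌊t⌋₊ hmem)).mono_of_mem_nhdsWithin ?_
  rw [mem_nhdsWithin_iff_exists_mem_nhds_inter]
  exact ⟨Iio (⌊t⌋₊ + 1), Iio_mem_nhds ht', fun s hs => ⟨hs.2, le_of_lt hs.1⟩⟩

lemma IsSolution.hasDerivWithinAt_comp {F : E → E} {x₀ : E} {x : ℝ → E} (h : IsSolution F x₀ x)
    {V : E → ℝ} (hV : Differentiable ℝ V) {t : ℝ} (ht : 0 ≤ t) :
    HasDerivWithinAt (V ∘ x) (fderiv ℝ V (x t) (F (x t))) (Ici 0) t :=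
  (hV (x t)).hasFDerivAt.comp_hasDerivWithinAt t (h.2 t ht)

/-- A sublevel set of `V` on whose boundary `V` strictly decreases is positively invariant. The
hypothesis concerns the vector field inside the sublevel set only. -/
lemma positivelyInvariant_of_fderiv_neg {F : E → E} {V : E → ℝ} (hV : Differentiable ℝ V)
    (h : ∀ x, V x = 1 → fderiv ℝ V x (F x) < 0) : PositivelyInvariant F {x | V x ≤ 1} := by
  intro x₀ hx₀ x hx t ht
  refine image_le_of_deriv_right_lt_deriv_boundary (f := V ∘ x)
    (f' := fun t => fderiv ℝ V (x t) (F (x t))) (a := 0) (b := t) (B := fun _ => 1)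
    (B' := fun _ => 0) (hV.continuous.comp_continuousOn
      (hx.continuousOn.mono Icc_subset_Ici_self)) (fun s hs => ?_) ?_
    (fun s => hasDerivAt_const s 1) (fun s _ hs => h _ hs) ⟨ht, le_rfl⟩
  · exact (hx.hasDerivWithinAt_comp hV hs.1).mono (Ici_subset_Ici.2 hs.1)
  · simpa [hx.1] using hx₀

lemma lyapunov_le_exp {F : E → E} {V : E → ℝ} (hV : Differentiable ℝ V) {κ : ℝ} {x₀ : E}
    {x : ℝ → E} (hx : IsSolution F x₀ x)
    (h : ∀ t, 0 ≤ t → fderiv ℝ V (x t) (F (x t)) ≤ -κ * V (x t)) {t : ℝ} (ht : 0 ≤ t) :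
    V (x t) ≤ Real.exp (-κ * t) * V x₀ := by
  have hd : ∀ s, 0 ≤ s → HasDerivWithinAt (fun s => Real.exp (κ * s) * (V ∘ x) s)
      (Real.exp (κ * s) * κ * (V ∘ x) s + Real.exp (κ * s) * fderiv ℝ V (x s) (F (x s)))
      (Ici 0) s := fun s hs => by
    have h1 : HasDerivAt (fun s => Real.exp (κ * s)) (Real.exp (κ * s) * κ) s := by
      simpa using ((hasDerivAt_id s).const_mul κ).exp
    exact h1.hasDerivWithinAt.mul (hx.hasDerivWithinAt_comp hV hs)
  have hanti : AntitoneOn (fun s => Real.exp (κ * s) * (V ∘ x) s) (Ici 0) := by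
    refine antitoneOn_of_hasDerivWithinAt_nonpos (convex_Ici 0)
      (fun s hs => (hd s hs).continuousWithinAt)
      (fun s hs => (hd s (interior_subset hs)).mono interior_subset) fun s hs => ?_
    have hs' : 0 ≤ s := interior_subset hs
    have := mul_le_mul_of_nonneg_left (h s hs') (Real.exp_pos (κ * s)).le
    simp only [Function.comp_apply]
    linarith
  have := hanti self_mem_Ici ht ht
  simp only [Function.comp_apply, hx.1, mul_zero, Real.exp_zero, one_mul] at this
  rw [neg_mul, Real.exp_neg, ← div_eq_inv_mul, le_div_iff₀ (Real.exp_pos _)]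
  linarith

/-- Exponential stability on a compact sublevel set of a Lyapunov function. The vector field is
only required to be regular on that set, where it agrees with a `C¹` field `H`: cutting `H` off
outside the set gives a field with global solutions, and neither its solutions nor those of `F` can
leave the set. -/
lemma exponentiallyStableOn_of_lyapunov [FiniteDimensional ℝ E] {F H : E → E} {V : E → ℝ}
    (hV : Differentiable ℝ V) (hcomp : IsCompact {x | V x ≤ 1}) (hH : ContDiff ℝ 1 H)
    (hFH : EqOn F H {x | V x ≤ 1}) {κ c₁ c₂ : ℝ} (hκ : 0 < κ) (hc₁ : 0 < c₁) (hc₂ : 0 < c₂)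
    (hdec : ∀ x, V x ≤ 1 → fderiv ℝ V x (F x) ≤ -κ * V x)
    (hlow : ∀ x, V x ≤ 1 → ‖x‖ ^ 2 ≤ c₁ * V x) (hup : ∀ x, V x ≤ 1 → V x ≤ c₂ * ‖x‖ ^ 2) :
    ExponentiallyStableOn F {x | V x ≤ 1} ∧ PositivelyInvariant F {x | V x ≤ 1} := by
  have hinv : ∀ F' : E → E, EqOn F' F {x | V x ≤ 1} → PositivelyInvariant F' {x | V x ≤ 1} :=
    fun F' hF' => positivelyInvariant_of_fderiv_neg hV fun x hx => by
      have := hdec x hx.le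
      rw [hF' (show V x ≤ 1 from hx.le)]
      rw [hx] at this
      linarith
  have hcongr : ∀ F₁ F₂ : E → E, EqOn F₁ F₂ {x | V x ≤ 1} →
      PositivelyInvariant F₁ {x | V x ≤ 1} → ∀ x₀ ∈ {x | V x ≤ 1}, ∀ x : ℝ → E,
      IsSolution F₁ x₀ x → IsSolution F₂ x₀ x := fun F₁ F₂ h12 hI x₀ hx₀ x hx =>
    ⟨hx.1, fun t ht => h12 (hI x₀ hx₀ x hx t ht) ▸ hx.2 t ht⟩
  obtain ⟨r, hr⟩ := hcomp.isBounded.subset_closedBall (0 : E)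
  let χ : ContDiffBump (0 : E) := ⟨max r 1, max r 1 + 1, by positivity, by linarith⟩
  let H' : E → E := fun x => χ x • H x
  have hH' : ContDiff ℝ 1 H' := χ.contDiff.smul hH
  have hsupp : HasCompactSupport H' := χ.hasCompactSupport.smul_right
  have hFH' : EqOn H' F {x | V x ≤ 1} := fun x hx => by
    have : χ x = 1 := χ.one_of_mem_closedBall
      (Metric.closedBall_subset_closedBall (le_max_left r 1) (hr hx))
    simp only [H', this, one_smul, hFH hx]
  obtain ⟨K, hK⟩ := hH'.lipschitzWith_of_hasCompactSupport hsupp one_ne_zero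
  obtain ⟨C, hC⟩ := hsupp.exists_bound_of_continuous hH'.continuous
  have hIF := hinv F fun _ _ => rfl
  have hIH := hinv H' hFH'
  have : CompleteSpace E := FiniteDimensional.complete ℝ E
  refine ⟨⟨fun x₀ hx₀ => ?_, Real.sqrt (c₁ * c₂), by positivity, κ / 2, by positivity,
    fun x₀ hx₀ x hx t ht => ?_⟩, hIF⟩
  · obtain ⟨x, hx⟩ := exists_isSolution_of_lipschitzWith hK hC x₀
    exact ⟨x, hcongr _ _ hFH' hIH x₀ hx₀ x hx, fun y hy =>
      hx.eqOn_of_lipschitzWith hK (hcongr _ _ hFH'.symm hIF x₀ hx₀ y hy)⟩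
  · have h1 := lyapunov_le_exp hV hx (fun s hs => hdec _ (hIF x₀ hx₀ x hx s hs)) ht
    have h2 : ‖x t‖ ^ 2 ≤ c₁ * (Real.exp (-κ * t) * (c₂ * ‖x₀‖ ^ 2)) :=
      (hlow _ (hIF x₀ hx₀ x hx t ht)).trans <| mul_le_mul_of_nonneg_left
        (h1.trans (mul_le_mul_of_nonneg_left (hup _ hx₀) (Real.exp_pos _).le)) hc₁.le
    refine le_of_sq_le_sq ?_ (by positivity)
    refine h2.trans_eq ?_
    rw [mul_pow, mul_pow, Real.sq_sqrt (by positivity), ← Real.exp_nat_mul]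
    have : ((2 : ℕ) : ℝ) * (-(κ / 2) * t) = -κ * t := by push_cast; ring
    rw [this]
    ring

end ODE

/-! ### The closed loop -/

/-- Any quadratic form is bounded by a multiple of a positive definite one, by compactness of the
unit sphere. -/
lemma exists_form_le {ι : Type*} [Fintype ι] (M : Matrix ι ι ℝ) {N : Matrix ι ι ℝ}
    (hN : N.PosDef) : ∃ C > (0 : ℝ), ∀ z : ι → ℝ, z ⬝ᵥ (M *ᵥ z) ≤ C * (z ⬝ᵥ (N *ᵥ z)) := by
  have hcont : ∀ M' : Matrix ι ι ℝ, Continuous fun z : ι → ℝ => z ⬝ᵥ (M' *ᵥ z) := fun M' => by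
    fun_prop
  have hpos : ∀ z : ι → ℝ, z ≠ 0 → 0 < z ⬝ᵥ (N *ᵥ z) := fun z hz => by
    simpa using hN.dotProduct_mulVec_pos hz
  have hne : ∀ z ∈ Metric.sphere (0 : ι → ℝ) 1, z ≠ 0 := by
    rintro z hz rfl
    simp at hz
  obtain ⟨C, hC⟩ := (isCompact_sphere (0 : ι → ℝ) 1).bddAbove_image
    ((hcont M).continuousOn.div (hcont N).continuousOn fun z hz => (hpos z (hne z hz)).ne')
  refine ⟨max C 1, by positivity, fun z => ?_⟩
  rcases eq_or_ne z 0 with rfl | hz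
  · simp
  · have hz' : 0 < ‖z‖ := norm_pos_iff.2 hz
    have h1 : (‖z‖⁻¹ • z) ∈ Metric.sphere (0 : ι → ℝ) 1 := by simp [norm_smul, hz'.ne']
    have h2 := (hC ⟨_, h1, rfl⟩).trans (le_max_left C 1)
    change _ / _ ≤ max C 1 at h2
    simp only [Matrix.mulVec_smul, smul_dotProduct, dotProduct_smul, smul_eq_mul, ← mul_assoc] at h2
    rw [mul_div_mul_left _ _ (by positivity), div_le_iff₀ (hpos z hz)] at h2
    exact h2

lemma hasFDerivAt_dotProduct_mulVec {E ι : Type*} [NormedAddCommGroup E] [NormedSpace ℝ E]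
    [Fintype ι] (M : Matrix ι ι ℝ) {Z : E → ι → ℝ} {Z' : E →L[ℝ] ι → ℝ} {x : E}
    (hZ : HasFDerivAt Z Z' x) :
    HasFDerivAt (fun y => Z y ⬝ᵥ (M *ᵥ Z y))
      (∑ k, (Z x k • (ContinuousLinearMap.proj k).comp
          ((LinearMap.toContinuousLinearMap M.mulVecLin).comp Z') +
        (M *ᵥ Z x) k • (ContinuousLinearMap.proj (R := ℝ) (φ := fun _ => ℝ) k).comp Z')) x := by
  have h1 : HasFDerivAt (fun y => M *ᵥ Z y)
      ((LinearMap.toContinuousLinearMap M.mulVecLin).comp Z') x :=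
    (LinearMap.toContinuousLinearMap M.mulVecLin).hasFDerivAt.comp x hZ
  exact HasFDerivAt.fun_sum fun k _ => (hasFDerivAt_pi'.1 hZ k).mul (hasFDerivAt_pi'.1 h1 k)

/-- The closed loop is stable as soon as the lifted state satisfies the bilinear differential
equation on `X`: `zᵀ P⁻¹ z` is a Lyapunov function. -/
lemma closedLoop_stable {n q : ℕ} {f g : EuclideanSpace ℝ (Fin n) → EuclideanSpace ℝ (Fin n)}
    {X : Set (EuclideanSpace ℝ (Fin n))} (hXcompact : IsCompact X) (hXconvex : Convex ℝ X)
    (h0X : 0 ∈ X) {ψ : Fin q → EuclideanSpace ℝ (Fin n) → ℝ} (hψ : ∀ k, ContDiff ℝ 2 (ψ k))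
    (hψ0 : ∀ k, ψ k 0 = 0)
    {A : Matrix (Fin n ⊕ Fin q) (Fin n ⊕ Fin q) ℝ} {B0 : Matrix (Fin n ⊕ Fin q) (Fin 1) ℝ}
    {B1 : Matrix (Fin n ⊕ Fin q) (Fin n ⊕ Fin q) ℝ}
    (hlift : ∀ x ∈ X, ∀ (u : ℝ) k, fderiv ℝ (fun y => liftHat ψ y k) x (f x + u • g x) =
      (A *ᵥ liftHat ψ x + u • (B0.col 0 + B1 *ᵥ liftHat ψ x)) k)
    {P : Matrix (Fin n ⊕ Fin q) (Fin n ⊕ Fin q) ℝ} {L : Matrix (Fin 1) (Fin n ⊕ Fin q) ℝ}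
    (hP : P.PosDef) {τ : ℝ} (hτ : 0 < τ)
    (hdec : ∀ z p : Fin n ⊕ Fin q → ℝ, P *ᵥ p = z → z ⬝ᵥ (P⁻¹ *ᵥ z) ≤ 1 →
      2 * (p ⬝ᵥ (A *ᵥ z + (L *ᵥ p) 0 • (B0.col 0 + B1 *ᵥ z))) ≤ -τ * (p ⬝ᵥ p))
    (hRX : regionOfAttraction ψ P ⊆ X) :
    ExponentiallyStableOn (fun x => f x + feedback ψ P L x • g x) (regionOfAttraction ψ P) ∧
    PositivelyInvariant (fun x => f x + feedback ψ P L x • g x) (regionOfAttraction ψ P) := by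
  set Z := liftHat ψ with hZ
  have hZd : ContDiff ℝ 2 Z := contDiff_liftHat hψ
  have hZd1 : Differentiable ℝ Z := hZd.differentiable (by norm_num)
  have hmul : ∀ {m : Type} [Fintype m] (M : Matrix m (Fin n ⊕ Fin q) ℝ),
      ContDiff ℝ 2 fun x => M *ᵥ Z x := fun M =>
    (LinearMap.toContinuousLinearMap M.mulVecLin).contDiff.comp hZd
  have hPi : P⁻¹.PosDef := hP.inv
  have hPu : IsUnit P.det := (Matrix.isUnit_iff_isUnit_det _).1 hP.isUnit
  have hone : (1 : Matrix (Fin n ⊕ Fin q) (Fin n ⊕ Fin q) ℝ).PosDef := Matrix.PosDef.one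
  obtain ⟨C₁, hC₁, hC₁'⟩ := exists_form_le 1 hPi
  obtain ⟨C₂, hC₂, hC₂'⟩ := exists_form_le P⁻¹ hone
  obtain ⟨C₃, hC₃, hC₃'⟩ := exists_form_le P hone
  simp only [Matrix.one_mulVec] at hC₁' hC₂' hC₃'
  let V : EuclideanSpace ℝ (Fin n) → ℝ := fun x => Z x ⬝ᵥ (P⁻¹ *ᵥ Z x)
  have hV : Differentiable ℝ V := fun x =>
    (hasFDerivAt_dotProduct_mulVec P⁻¹ (hZd1 x).hasFDerivAt).differentiableAt
  have hVfderiv : ∀ x v, fderiv ℝ V x v = 2 * ((P⁻¹ *ᵥ Z x) ⬝ᵥ fderiv ℝ Z x v) := by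
    intro x v
    rw [(hasFDerivAt_dotProduct_mulVec P⁻¹ (hZd1 x).hasFDerivAt).fderiv]
    simp only [sum_apply, add_apply,
      smul_apply, ContinuousLinearMap.comp_apply, smul_eq_mul,
      ContinuousLinearMap.proj_apply, Finset.sum_add_distrib, LinearMap.coe_toContinuousLinearMap',
      Matrix.mulVecLin_apply]
    change Z x ⬝ᵥ (P⁻¹ *ᵥ fderiv ℝ Z x v) + (P⁻¹ *ᵥ Z x) ⬝ᵥ fderiv ℝ Z x v = _
    rw [mulVec_dotProduct_comm hPi.isHermitian, dotProduct_comm (P⁻¹ *ᵥ Z x)]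
    ring
  let H : EuclideanSpace ℝ (Fin n) → EuclideanSpace ℝ (Fin n) := fun x => WithLp.toLp 2 fun i =>
    (A *ᵥ Z x + feedback ψ P L x • (B0.col 0 + B1 *ᵥ Z x)) (Sum.inl i)
  have hfb : ContDiff ℝ 2 (feedback ψ P L) := contDiff_pi.1 (hmul (L * P⁻¹)) 0
  have hH : ContDiff ℝ 1 H := by
    rw [contDiff_euclidean]
    intro i
    have hA := contDiff_pi.1 (hmul A) (Sum.inl i)
    have hB := contDiff_pi.1 (hmul B1) (Sum.inl i)
    exact (hA.add (hfb.mul (contDiff_const.add hB))).of_le (by norm_num)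
  have hset : regionOfAttraction ψ P = {x | V x ≤ 1} := rfl
  have hFH : EqOn (fun x => f x + feedback ψ P L x • g x) H {x | V x ≤ 1} := by
    intro x hx
    ext i
    have := hlift x (hRX hx) (feedback ψ P L x) (Sum.inl i)
    rwa [fderiv_liftHat_inl] at this
  have hcomp : IsCompact {x | V x ≤ 1} :=
    hXcompact.of_isClosed_subset (isClosed_le hV.continuous continuous_const) hRX
  obtain ⟨C₄, hC₄⟩ := hXcompact.exists_bound_of_continuousOn
    (hZd.continuous_fderiv (by norm_num)).continuousOn
  have hZbound : ∀ x ∈ X, ‖Z x‖ ≤ C₄ * ‖x‖ := fun x hx => by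
    have := hXconvex.norm_image_sub_le_of_norm_fderiv_le (fun y _ => hZd1 y) hC₄ h0X hx
    simpa [hZ, liftHat_zero hψ0] using this
  have hself : ∀ z : Fin n ⊕ Fin q → ℝ, z ⬝ᵥ z ≤ (Fintype.card (Fin n ⊕ Fin q)) * ‖z‖ ^ 2 := by
    intro z
    have : ∀ k ∈ Finset.univ, z k * z k ≤ ‖z‖ ^ 2 := fun k _ => by
      have := norm_le_pi_norm z k
      rw [← sq, ← sq_abs]
      exact pow_le_pow_left₀ (abs_nonneg _) this 2
    simpa [dotProduct] using Finset.sum_le_card_nsmul _ _ _ this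
  rw [hset]
  refine exponentiallyStableOn_of_lyapunov hV hcomp hH hFH (κ := τ / C₃) (c₁ := C₁)
    (c₂ := C₂ * (Fintype.card (Fin n ⊕ Fin q) * C₄ ^ 2) + 1) (by positivity) hC₁ (by positivity)
    (fun x hx => ?_) (fun x hx => ?_) (fun x hx => ?_)
  · set p := P⁻¹ *ᵥ Z x with hp
    have hPp : P *ᵥ p = Z x := by
      rw [hp, Matrix.mulVec_mulVec, Matrix.mul_nonsing_inv _ hPu, Matrix.one_mulVec]
    have h1 := hdec (Z x) p hPp hx
    have hLp : (L *ᵥ p) 0 = feedback ψ P L x := by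
      rw [hp, Matrix.mulVec_mulVec]
      rfl
    have h2 : fderiv ℝ Z x (f x + feedback ψ P L x • g x) =
        A *ᵥ Z x + feedback ψ P L x • (B0.col 0 + B1 *ᵥ Z x) := by
      ext k
      rw [← hlift x (hRX hx), (hasFDerivAt_pi'.1 (hZd1 x).hasFDerivAt k).fderiv]
      rfl
    rw [hVfderiv, h2, ← hp, ← hLp]
    refine h1.trans ?_
    have h3 := hC₃' p
    rw [hPp, dotProduct_comm] at h3
    have h4 : V x ≤ C₃ * (p ⬝ᵥ p) := h3
    rw [neg_mul, neg_mul, neg_le_neg_iff, div_mul_eq_mul_div, div_le_iff₀ hC₃]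
    nlinarith
  · refine le_trans ?_ (hC₁' (Z x))
    rw [EuclideanSpace.real_norm_sq_eq]
    simp only [dotProduct, Fintype.sum_sum_type, ← sq]
    exact le_add_of_nonneg_right (Finset.sum_nonneg fun _ _ => sq_nonneg _)
  · have h1 := hZbound x (hRX hx)
    have h2 : ‖Z x‖ ^ 2 ≤ C₄ ^ 2 * ‖x‖ ^ 2 := by
      rw [← mul_pow]
      exact pow_le_pow_left₀ (norm_nonneg _) h1 2
    calc V x ≤ C₂ * (Z x ⬝ᵥ Z x) := hC₂' _
      _ ≤ C₂ * (Fintype.card (Fin n ⊕ Fin q) * (C₄ ^ 2 * ‖x‖ ^ 2)) := by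
        gcongr
        exact (hself _).trans (by gcongr)
      _ ≤ (C₂ * (Fintype.card (Fin n ⊕ Fin q) * C₄ ^ 2) + 1) * ‖x‖ ^ 2 := by
        nlinarith [sq_nonneg ‖x‖]

end KoopmanFeedback

theorem theorem1 {n q : ℕ}
    -- the unknown single-input system, the state region and the input set
    (f g : EuclideanSpace ℝ (Fin n) → EuclideanSpace ℝ (Fin n)) (hf0 : f 0 = 0)
    (X : Set (EuclideanSpace ℝ (Fin n))) (hXcompact : IsCompact X) (hXconvex : Convex ℝ X)
    (U : Set ℝ) (hUcompact : IsCompact U) (hU0 : (0 : ℝ) ∈ interior U)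
    -- existence and uniqueness of the solutions for constant inputs
    (hwp : ∀ u ∈ U, KoopmanFeedback.WellPosedOn (fun y => f y + u • g y) X)
    -- the dictionary
    (ψ : Fin q → EuclideanSpace ℝ (Fin n) → ℝ)
    (hψ : ∀ k, ContDiff ℝ 2 (ψ k)) (hψ0 : ∀ k, ψ k 0 = 0)
    (hinv : KoopmanFeedback.InvariantDictionary f g X U ψ)
    -- the sampling law on `X`; the observables are linearly independent in `L²(ρ)`
    (ρ : Measure (EuclideanSpace ℝ (Fin n))) [IsProbabilityMeasure ρ] (hρX : ρ Xᶜ = 0)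
    (hρ : ∀ a : Fin 1 ⊕ (Fin n ⊕ Fin q) → ℝ,
      (∀ᵐ x ∂ρ, a ⬝ᵥ KoopmanFeedback.lift ψ x = 0) → a = 0)
    -- the error bound and the probabilistic tolerance
    (c_r : ℝ) (hc_r : 0 < c_r) (δ : ℝ) (hδ : δ ∈ Ioo (0 : ℝ) 1) :
    ∃ d_min : ℕ, ∀ d0 ≥ d_min, ∀ d1 ≥ d_min,
      ∃ G : Set ((Fin d0 → EuclideanSpace ℝ (Fin n)) × (Fin d1 → EuclideanSpace ℝ (Fin n))),
        MeasurableSet G ∧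
        ENNReal.ofReal (1 - δ) ≤
          ((Measure.pi fun _ : Fin d0 => ρ).prod (Measure.pi fun _ : Fin d1 => ρ)) G ∧
        ∀ s ∈ G,
          ∀ (A : Matrix (Fin n ⊕ Fin q) (Fin n ⊕ Fin q) ℝ)
            (B0 : Matrix (Fin n ⊕ Fin q) (Fin 1) ℝ)
            (B1 : Matrix (Fin n ⊕ Fin q) (Fin n ⊕ Fin q) ℝ),
            KoopmanFeedback.IsEDMD f g ψ s.1 s.2 A B0 B1 →
          ∀ (Q : Matrix (Fin n ⊕ Fin q) (Fin n ⊕ Fin q) ℝ)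
            (S : Matrix (Fin n ⊕ Fin q) (Fin 1) ℝ) (R : ℝ),
            (-Q).PosDef → 0 < R →
          ∀ (P : Matrix (Fin n ⊕ Fin q) (Fin n ⊕ Fin q) ℝ)
            (L : Matrix (Fin 1) (Fin n ⊕ Fin q) ℝ) (lam ν τ : ℝ),
            P.PosDef → 0 < lam → 0 < ν → 0 < τ →
            (KoopmanFeedback.stabilityMatrix A B0 B1 Q S R c_r P L lam τ).PosDef →
            (KoopmanFeedback.inclusionMatrix Q S R P ν).PosSemidef →
            KoopmanFeedback.regionOfAttraction ψ P ⊆ X →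
            KoopmanFeedback.ExponentiallyStableOn
              (fun x => f x + KoopmanFeedback.feedback ψ P L x • g x)
              (KoopmanFeedback.regionOfAttraction ψ P) ∧
            KoopmanFeedback.PositivelyInvariant
              (fun x => f x + KoopmanFeedback.feedback ψ P L x • g x)
              (KoopmanFeedback.regionOfAttraction ψ P) := by
  obtain ⟨T, hT, hTV, hTspan⟩ :=
    KoopmanFeedback.exists_finite_open_sets (KoopmanFeedback.continuous_lift hψ) hρ
  have hδ2 : 0 < δ / 2 := half_pos hδ.1
  obtain ⟨d_min, hd⟩ := Filter.eventually_atTop.1 (KoopmanFeedback.eventually_le_pi_visits ρ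
    hXcompact.isClosed.measurableSet hρX hT
    (fun V hV => ⟨(hTV V hV).1.measurableSet, (hTV V hV).2⟩) hδ2)
  refine ⟨d_min, fun d0 hd0 d1 hd1 => ?_⟩
  obtain ⟨G0, hG0, hμ0, hG0'⟩ := hd d0 hd0
  obtain ⟨G1, hG1, hμ1, hG1'⟩ := hd d1 hd1
  refine ⟨G0 ×ˢ G1, hG0.prod hG1, ?_, ?_⟩
  · rw [Measure.prod_prod]
    refine le_trans ?_ (mul_le_mul' hμ0 hμ1)
    rw [← ENNReal.ofReal_mul (by linarith [hδ.2])]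
    exact ENNReal.ofReal_le_ofReal (by nlinarith [sq_nonneg δ])
  · rintro ⟨x0, x1⟩ ⟨hx0, hx1⟩ A B0 B1 hAB Q S R hQ hR P L lam ν τ hP hlam hν hτ hstab hincl hRX
    -- the region of attraction contains the origin, so its inclusion in `X` gives `0 ∈ X`
    have h0X : (0 : EuclideanSpace ℝ (Fin n)) ∈ X := hRX (by
      simp [KoopmanFeedback.regionOfAttraction, KoopmanFeedback.liftHat_zero hψ0])
    have hspan : ∀ {d : ℕ} (x : Fin d → EuclideanSpace ℝ (Fin n)),
        (∀ V ∈ T, (V ∩ range x).Nonempty) →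
        ∀ a, (∀ j, a ⬝ᵥ KoopmanFeedback.lift ψ (x j) = 0) → a = 0 := fun x hx a ha =>
      hTspan (range x) hx a (forall_mem_range.2 ha)
    refine KoopmanFeedback.closedLoop_stable hXcompact hXconvex h0X hψ hψ0 (fun x hx u k =>
      KoopmanFeedback.fderiv_liftHat_of_isEDMD hf0 h0X hU0 hwp hψ hψ0 hinv (hG0' x0 hx0).1
        (hG1' x1 hx1).1 (hspan x0 (hG0' x0 hx0).2) (hspan x1 (hG1' x1 hx1).2) hAB hx u k)
      hP hτ (fun z p hp hz => ?_) hRX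
    exact KoopmanFeedback.lyapunov_decrease hQ hR hP hlam hstab hp
      (KoopmanFeedback.multiplier_form_nonneg hQ hP hν hincl hz)
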